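/- Let $I\subseteq\mathbb R$ be an open set and consider differential polynomials, i.e. polynomials in $u_x,u_{xx},\dots$ whose coefficients are smooth functions of $u\in I$, graded by $\deg u^{(k)}=k$. For a differential polynomial $h$, $\int h\,dx$ denotes its class modulo the image of the total derivative $\partial_x=u_x\frac{\partial}{\partial u}+u_{xx}\frac{\partial}{\partial u_x}+\dots$, and $$\{H,F\}=\int \frac{\delta H}{\delta u(x)}\,\partial_x\frac{\delta F}{\delta u(x)}\,dx,\qquad \frac{\delta H}{\delta u(x)}=\frac{\partial h}{\partial u}-\partial_x\frac{\partial h}{\partial u_x}+\partial_x^2\frac{\partial h}{\partial u_{xx}}-\dots$$ For a smooth function $f=f(u)$ on $I$, a perturbation of $\int f\,dx$ is a formal series $\int (f(u)+\sum_{k\ge1}\epsilon^k h_k)\,dx$ with $h_k$ a differential polynomial homogeneous of degree $k$. A perturbation $H$ of $\int\frac{u^3}{6}dx$ is called $N$-integrable if for every smooth function $f$ on $I$ there is a perturbation $H_f$ of $\int f\,dx$ such that $H_f=H$ for $f=\frac{u^3}{6}$ and $\{H_f,H_g\}=\mathcal O(\epsilon^{N+1})$ for all smooth $f,g$. Let $p$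 be a smooth function on $I$ that is not identically zero (for example, nowhere vanishing). Then the Hamiltonian $$H=\int\left[\frac{u^3}{6}+\epsilon^4p(u)\,u_{xx}^2\right]dx$$ cannot be included into a $9$-integrable family: no perturbation $\tilde H$ of $\int\frac{u^3}{6}dx$ with $\tilde H=H+\mathcal O(\epsilon^5)$ is $9$-integrable. In particular, $H$ itself is not $9$-integrable. -/

import Mathlib

open scoped ContDiff

noncomputable section

namespace HopfPerturbation

/-! ### Smooth functions of `u` on an open set of the real line -/

/-- Extension by zero to the whole line of a function on an open set of the line. -/
def ext {I : TopologicalSpace.Opens ℝ} (f : I → ℝ) : ℝ → ℝ :=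
  Function.extend Subtype.val f 0

theorem ext_coe {I : TopologicalSpace.Opens ℝ} (f : I → ℝ) (x : I) : ext f x = f x :=
  Subtype.val_injective.extend_apply f 0 x

theorem ext_of_mem {I : TopologicalSpace.Opens ℝ} (f : I → ℝ) {x : ℝ} (hx : x ∈ I) :
    ext f x = f ⟨x, hx⟩ :=
  ext_coe f ⟨x, hx⟩

/-- The real algebra of smooth functions on the open set `I` of the real line. -/
def SmoothFun (I : TopologicalSpace.Opens ℝ) : Subalgebra ℝ (I → ℝ) where
  carrier := {f | ContDiffOn ℝ ∞ (ext f) I}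
  mul_mem' {f g} hf hg := by
    refine (ContDiffOn.mul hf hg).congr fun x hx => ?_
    simp only [ext_of_mem _ (show x ∈ I from hx), Pi.mul_apply]
  add_mem' {f g} hf hg := by
    refine (ContDiffOn.add hf hg).congr fun x hx => ?_
    simp only [ext_of_mem _ (show x ∈ I from hx), Pi.add_apply]
  algebraMap_mem' r := by
    refine (contDiffOn_const (c := r)).congr fun x hx => ?_
    simp only [ext_of_mem _ (show x ∈ I from hx), Pi.algebraMap_apply, Algebra.algebraMap_self,
      RingHom.id_apply]

variable {I : TopologicalSpace.Opens ℝ}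

theorem contDiffOn_ext (f : SmoothFun I) : ContDiffOn ℝ ∞ (ext f.1) I := f.2

theorem differentiableAt_ext (f : SmoothFun I) (x : I) :
    DifferentiableAt ℝ (ext f.1) x :=
  ((contDiffOn_ext f).contDiffAt (I.isOpen.mem_nhds x.2)).differentiableAt (by simp)

theorem deriv_ext_mem (f : SmoothFun I) : (fun x : I => deriv (ext f.1) x) ∈ SmoothFun I := by
  refine ((contDiffOn_infty_iff_deriv_of_isOpen I.isOpen).1 (contDiffOn_ext f)).2.congr fun x hx => ?_
  exact ext_of_mem _ (show x ∈ I from hx)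

/-- The derivative `f ↦ f'` on smooth functions on `I`. -/
def derivU (I : TopologicalSpace.Opens ℝ) : Derivation ℝ (SmoothFun I) (SmoothFun I) where
  toFun f := ⟨fun x => deriv (ext f.1) x, deriv_ext_mem f⟩
  map_add' f g := by
    ext x
    have h : ext (f + g).1 =ᶠ[nhds (x : ℝ)] ext f.1 + ext g.1 := by
      filter_upwards [I.isOpen.mem_nhds x.2] with y hy
      simp only [ext_of_mem _ (show y ∈ I from hy), Pi.add_apply]
      rfl
    change deriv (ext (f + g).1) x = deriv (ext f.1) x + deriv (ext g.1) x
    rw [h.deriv_eq, deriv_add (differentiableAt_ext f x) (differentiableAt_ext g x)]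
  map_smul' r f := by
    ext x
    have h : ext (r • f).1 =ᶠ[nhds (x : ℝ)] fun y => r * ext f.1 y := by
      filter_upwards [I.isOpen.mem_nhds x.2] with y hy
      simp only [ext_of_mem _ (show y ∈ I from hy)]
      rfl
    change deriv (ext (r • f).1) x = r * deriv (ext f.1) x
    rw [h.deriv_eq, deriv_const_mul r (differentiableAt_ext f x)]
  map_one_eq_zero' := by
    ext x
    have h : ext (1 : SmoothFun I).1 =ᶠ[nhds (x : ℝ)] fun _ => (1 : ℝ) := by
      filter_upwards [I.isOpen.mem_nhds x.2] with y hy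
      rw [ext_of_mem _ (show y ∈ I from hy)]
      rfl
    change deriv (ext (1 : SmoothFun I).1) x = 0
    rw [h.deriv_eq, deriv_const]
  leibniz' f g := by
    ext x
    have h : ext (f * g).1 =ᶠ[nhds (x : ℝ)] ext f.1 * ext g.1 := by
      filter_upwards [I.isOpen.mem_nhds x.2] with y hy
      simp only [ext_of_mem _ (show y ∈ I from hy), Pi.mul_apply]
      rfl
    change deriv (ext (f * g).1) x = f.1 x * deriv (ext g.1) x + g.1 x * deriv (ext f.1) x
    rw [h.deriv_eq, deriv_mul (differentiableAt_ext f x) (differentiableAt_ext g x), ext_coe, ext_coe]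
    ring

/-- The coordinate function `u`. -/
def coordU (I : TopologicalSpace.Opens ℝ) : SmoothFun I :=
  ⟨fun x => x, contDiffOn_id.congr fun x hx => ext_of_mem _ (show x ∈ I from hx)⟩

/-- The function `u ^ 3 / 6`, density of the Hopf Hamiltonian. -/
def hopfDensity (I : TopologicalSpace.Opens ℝ) : SmoothFun I :=
  (1 / 6 : ℝ) • coordU I ^ 3

/-! ### Formal calculus of variations -/

/-- Differential polynomials in one dependent variable `u`: polynomials in `u_x, u_xx, …` with
coefficients smooth functions of `u`. The variable `X i` is the derivative of `u` of order `i + 1`,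
so that `X 0 = u_x` and `X 1 = u_xx`. -/
abbrev DiffPoly (I : TopologicalSpace.Opens ℝ) : Type := MvPolynomial ℕ (SmoothFun I)

/-- The partial derivative `∂/∂u`, which differentiates the coefficients. -/
def partialU (P : DiffPoly I) : DiffPoly I :=
  ∑ m ∈ P.support, MvPolynomial.monomial m (derivU I (P.coeff m))

/-- The total `x`-derivative `u_x ∂/∂u + u_xx ∂/∂u_x + …`. -/
def totalDeriv (P : DiffPoly I) : DiffPoly I :=
  MvPolynomial.X 0 * partialU P +
    ∑ i ∈ P.vars, MvPolynomial.X (i + 1) * MvPolynomial.pderiv i P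

/-- The Euler–Lagrange derivative `∂h/∂u - ∂ₓ (∂h/∂u_x) + ∂ₓ² (∂h/∂u_xx) - …` of `∫ h dx`. -/
def varDeriv (P : DiffPoly I) : DiffPoly I :=
  partialU P + ∑ i ∈ P.vars, (-1) ^ (i + 1) * totalDeriv^[i + 1] (MvPolynomial.pderiv i P)

/-- The local functionals `∫ P dx` and `∫ Q dx` are equal: their densities differ by a total
`x`-derivative. -/
def SameFunctional (P Q : DiffPoly I) : Prop :=
  ∃ R : DiffPoly I, P - Q = totalDeriv R

/-- Density of the Poisson bracket `{∫ P dx, ∫ Q dx}`. -/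
def bracket (P Q : DiffPoly I) : DiffPoly I :=
  varDeriv P * totalDeriv (varDeriv Q)

/-! ### Perturbed Hamiltonians -/

/-- A formal series `∫ (f(u) + ε h₁ + ε² h₂ + …) dx`, where the coefficient `h k` of `ε ^ k` is a
differential polynomial of degree `k` for `deg u = 0`, `deg u_x = 1`, `deg u_xx = 2`, …; that is,
a density of the form `h(u, ε u_x, ε² u_xx, …)` with leading term `f(u)`. -/
structure PerturbedHamiltonian (I : TopologicalSpace.Opens ℝ) (f : SmoothFun I) where
  /-- The coefficients of the powers of `ε` in the density. -/
  h : ℕ → DiffPoly I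
  homogeneous : ∀ k, MvPolynomial.IsWeightedHomogeneous (fun i : ℕ => i + 1) (h k) k
  leading : h 0 = MvPolynomial.C f

/-- `H` and `G` are equal modulo `O(ε ^ (N + 1))`, as formal series of local functionals. -/
def AgreeUpTo (N : ℕ) {f g : SmoothFun I} (H : PerturbedHamiltonian I f)
    (G : PerturbedHamiltonian I g) : Prop :=
  ∀ k ≤ N, SameFunctional (H.h k) (G.h k)

/-- `{H, G} = O(ε ^ (N + 1))`. -/
def CommuteUpTo (N : ℕ) {f g : SmoothFun I} (H : PerturbedHamiltonian I f)
    (G : PerturbedHamiltonian I g) : Prop :=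
  ∀ n ≤ N, SameFunctional (∑ ij ∈ Finset.HasAntidiagonal.antidiagonal n, bracket (H.h ij.1) (G.h ij.2)) 0

/-- `N`-integrability of a perturbation `H` of the Hopf Hamiltonian `∫ u³/6 dx`: there is a family
`H_f = ∫ f dx + O(ε)`, `f` an arbitrary smooth function of `u`, with `H_f = H` for `f = u³/6` and
`{H_f, H_g} = O(ε ^ (N + 1))` for all `f` and `g`. -/
def IsIntegrable (N : ℕ) (H : PerturbedHamiltonian I (hopfDensity I)) : Prop :=
  ∃ F : ∀ f : SmoothFun I, PerturbedHamiltonian I f,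
    (∀ k, SameFunctional ((F (hopfDensity I)).h k) (H.h k)) ∧
      ∀ f g : SmoothFun I, CommuteUpTo N (F f) (F g)

/-- The Hamiltonian `∫ (u³/6 + ε⁴ p(u) u_xx²) dx`. -/
def quinticHamiltonian (p : SmoothFun I) : PerturbedHamiltonian I (hopfDensity I) where
  h k := if k = 0 then MvPolynomial.C (hopfDensity I)
    else if k = 4 then MvPolynomial.C p * MvPolynomial.X 1 ^ 2 else 0
  homogeneous k := by
    split_ifs with h0 h4
    · subst h0
      exact MvPolynomial.isWeightedHomogeneous_C _ _
    · subst h4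
      simpa using (MvPolynomial.isWeightedHomogeneous_C (fun i : ℕ => i + 1) p).mul
        ((MvPolynomial.isWeightedHomogeneous_X (SmoothFun I) (fun i : ℕ => i + 1) 1).pow 2)
    · exact MvPolynomial.isWeightedHomogeneous_zero _ _ _
  leading := if_pos rfl

end HopfPerturbation

end

open scoped ContDiff

noncomputable section

namespace HopfPerturbation

variable {I : TopologicalSpace.Opens ℝ}

open MvPolynomial

/-! Only two members of a supposed commuting family matter: those with leading terms f = u³/6 and g
= u⁴/24, for which f''' = 1 and g''' = u. Write h_i and k_j for their coefficients.

A local functional is tested on u = x + s₁ exp(ξ₁t) + s₂ exp(ξ₂t) + s₃ exp(ξ₃t) with s_i² = 0. When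
ξ₁ + ξ₂ + ξ₃ = 0, the coefficient of s₁s₂s₃ kills every total derivative
(`SameFunctional.top_expand`), so vanishing of a bracket becomes an algebraic identity in the ξ's at
each point x.

The quadratic part at x of a functional of degree n is a single number, `dispersionCoeff`, which
vanishes for odd n. The bracket of such a functional with ∫ g dx is tested by g''' times this number
times the power sum ξ₁ⁿ⁺¹ + ξ₂ⁿ⁺¹ + ξ₃ⁿ⁺¹, up to sign (`top_expand_bracket_C`). Order 2 thus makes
k₂ trivial, and order 4 forces k₄ to have u_xx² coefficient q = u p.

At order 8 the unknown h₈ and k₈ enter only through the ninth power sum, and `exists_resonant_triad`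
makes that sum zero. Trivial terms and odd-odd terms drop out as well. What remains is {h₄, k₄}, a
nonzero constant times q p' - p q' = -p² (`top_expand_bracket_normal_form_four`). Hence p = 0
everywhere. -/

instance : CommRing (SmoothFun I) := Subalgebra.toCommRing _

instance : Algebra ℝ (SmoothFun I) := Subalgebra.algebra _

instance : CommRing (DiffPoly I) := inferInstanceAs (CommRing (MvPolynomial ℕ (SmoothFun I)))

instance : Algebra (SmoothFun I) (DiffPoly I) :=
  inferInstanceAs (Algebra (SmoothFun I) (MvPolynomial ℕ (SmoothFun I)))

instance : Algebra ℝ (DiffPoly I) := inferInstanceAs (Algebra ℝ (MvPolynomial ℕ (SmoothFun I)))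

instance : IsScalarTower ℝ (SmoothFun I) (DiffPoly I) :=
  inferInstanceAs (IsScalarTower ℝ (SmoothFun I) (MvPolynomial ℕ (SmoothFun I)))

/-! ### Total and variational derivatives through derivations -/

theorem coeff_partialU (P : DiffPoly I) (m : ℕ →₀ ℕ) :
    (partialU P).coeff m = derivU I (P.coeff m) := by
  classical
  simp only [partialU, coeff_sum, coeff_monomial, Finset.sum_ite_eq', mem_support_iff]
  split_ifs with h
  · rfl
  · rw [not_not.1 h, map_zero]

/-- `∂/∂u` as a derivation. -/
def partialUDerivation (I : TopologicalSpace.Opens ℝ) :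
    Derivation ℝ (DiffPoly I) (DiffPoly I) where
  toFun := partialU
  map_add' P Q := by ext1 m; simp [coeff_partialU]
  map_smul' r P := by ext1 m; simp [coeff_partialU, coeff_smul]
  map_one_eq_zero' := by
    ext1 m
    change (partialU 1).coeff m = coeff m 0
    rw [coeff_partialU, coeff_one]
    split_ifs <;> simp
  leibniz' P Q := by
    ext1 m
    change (partialU (P * Q)).coeff m = coeff m (P • partialU Q + Q • partialU P)
    rw [smul_eq_mul, smul_eq_mul, mul_comm Q, coeff_partialU, coeff_add, coeff_mul, coeff_mul,
      coeff_mul, map_sum, ← Finset.sum_add_distrib]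
    refine Finset.sum_congr rfl fun x _ => ?_
    rw [Derivation.leibniz, coeff_partialU, coeff_partialU, smul_eq_mul, smul_eq_mul,
      mul_comm (coeff x.2 Q)]

theorem partialU_C (f : SmoothFun I) : partialU (C f) = C (derivU I f) := by
  ext1 m
  rw [coeff_partialU, coeff_C, coeff_C]
  split_ifs <;> simp

theorem partialU_X (i : ℕ) : partialU (X i : DiffPoly I) = 0 := by
  ext1 m
  rw [coeff_partialU, coeff_X, coeff_zero]
  split_ifs <;> simp

/-- `∂/∂u^{(k)}` as a derivation over `ℝ`; `∂/∂u` is the case `k = 0`. -/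
def jetDerivation (I : TopologicalSpace.Opens ℝ) : ℕ → Derivation ℝ (DiffPoly I) (DiffPoly I)
  | 0 => partialUDerivation I
  | i + 1 => (pderiv i).restrictScalars ℝ

theorem jetDerivation_zero (P : DiffPoly I) : jetDerivation I 0 P = partialU P := rfl

theorem jetDerivation_succ (i : ℕ) (P : DiffPoly I) : jetDerivation I (i + 1) P = pderiv i P := rfl

/-- Two derivations that agree on the variables of P agree at P. This removes the P-dependent index
set `P.vars` from the total derivative and so exhibits it as a derivation. -/
theorem mkDerivation_eq_sum_vars {σ R : Type*} [CommRing R] (f : σ → MvPolynomial σ R)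
    (P : MvPolynomial σ R) : mkDerivation R f P = ∑ i ∈ P.vars, f i * pderiv i P := by
  classical
  have hs : ∀ (s : Finset σ) (Q : MvPolynomial σ R),
      (∑ i ∈ s, f i • pderiv (R := R) i) Q = ∑ i ∈ s, (f i • pderiv (R := R) i) Q := fun s Q =>
    map_sum (⟨⟨fun D => D Q, rfl⟩, fun _ _ => rfl⟩ :
      Derivation R (MvPolynomial σ R) (MvPolynomial σ R) →+ MvPolynomial σ R) _ s
  have h : mkDerivation R f P = (∑ i ∈ P.vars, f i • pderiv (R := R) i) P := by
    refine derivation_eq_of_forall_mem_vars fun i hi => ?_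
    rw [mkDerivation_X, hs]
    simp only [Derivation.smul_apply, pderiv_X, Pi.single_apply, smul_eq_mul, mul_ite, mul_one,
      mul_zero]
    rw [Finset.sum_ite_eq P.vars i, if_pos hi]
  rw [h, hs]
  rfl

/-- The product of an element of a commutative algebra and a derivation of that algebra. -/
def mulDerivation {R A : Type*} [CommRing R] [CommRing A] [Algebra R A] (a : A)
    (D : Derivation R A A) : Derivation R A A := a • D

/-- The total `x`-derivative as a derivation. -/
def totalDerivation (I : TopologicalSpace.Opens ℝ) : Derivation ℝ (DiffPoly I) (DiffPoly I) :=
  mulDerivation (X 0) (partialUDerivation I) +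
    (mkDerivation (SmoothFun I) fun i => X (i + 1)).restrictScalars ℝ

theorem totalDerivation_apply (P : DiffPoly I) : totalDerivation I P = totalDeriv P := by
  change X 0 * partialU P + mkDerivation (SmoothFun I) (fun i => X (i + 1)) P = totalDeriv P
  rw [totalDeriv, mkDerivation_eq_sum_vars]

theorem totalDeriv_C (f : SmoothFun I) : totalDeriv (C f) = X 0 * C (derivU I f) := by
  simp [totalDeriv, partialU_C]

theorem totalDeriv_X (i : ℕ) : totalDeriv (X i : DiffPoly I) = X (i + 1) := by
  rw [← totalDerivation_apply]
  change X 0 * partialU (X i) + mkDerivation (SmoothFun I) (fun i => X (i + 1)) (X i) = _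
  rw [partialU_X, mkDerivation_X, mul_zero, zero_add]

theorem totalDeriv_add (P Q : DiffPoly I) :
    totalDeriv (P + Q) = totalDeriv P + totalDeriv Q := by
  simp only [← totalDerivation_apply, map_add]

theorem totalDeriv_zero : totalDeriv (0 : DiffPoly I) = 0 := by
  simp only [← totalDerivation_apply, map_zero]

theorem totalDeriv_neg (P : DiffPoly I) : totalDeriv (-P) = -totalDeriv P := by
  simp only [← totalDerivation_apply, map_neg]

theorem totalDeriv_mul (P Q : DiffPoly I) :
    totalDeriv (P * Q) = P * totalDeriv Q + Q * totalDeriv P := by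
  simp only [← totalDerivation_apply, Derivation.leibniz, smul_eq_mul]

/-- These derivations are linear over ℝ only and act on coefficients too, so the variables alone do
not determine them. -/
theorem derivation_ext_C_X {D₁ D₂ : Derivation ℝ (DiffPoly I) (DiffPoly I)}
    (hC : ∀ f, D₁ (C f) = D₂ (C f)) (hX : ∀ i, D₁ (X i) = D₂ (X i)) : D₁ = D₂ := by
  ext1 P
  induction P using MvPolynomial.induction_on with
  | C f => exact hC f
  | add P Q hP hQ => rw [map_add, map_add, hP, hQ]
  | mul_X P i hP => rw [Derivation.leibniz, Derivation.leibniz, hP, hX]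

theorem partialU_totalDeriv (P : DiffPoly I) :
    partialU (totalDeriv P) = totalDeriv (partialU P) := by
  have h : ⁅partialUDerivation I, totalDerivation I⁆ = 0 := by
    refine derivation_ext_C_X (fun f => ?_) fun i => ?_
    · rw [Derivation.commutator_apply, totalDerivation_apply, totalDerivation_apply, totalDeriv_C,
        Derivation.leibniz]
      change X 0 * partialU (C _) + C _ * partialU (X 0) - totalDeriv (partialU (C f)) = 0
      rw [partialU_C, partialU_C, partialU_X, totalDeriv_C, mul_zero, add_zero, sub_self]
    · rw [Derivation.commutator_apply, totalDerivation_apply, totalDerivation_apply, totalDeriv_X]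
      change partialU _ - totalDeriv (partialU _) = 0
      rw [partialU_X, partialU_X, totalDeriv_zero, sub_zero]
  have := congrArg (fun D => D P) h
  rw [Derivation.commutator_apply, totalDerivation_apply, totalDerivation_apply] at this
  exact sub_eq_zero.1 this

/-- The commutator of ∂/∂u^(i+1) with ∂ₓ is a derivation, so it is enough to compare it with
∂/∂u^(i) on coefficients and variables. -/
theorem pderiv_totalDeriv (i : ℕ) (P : DiffPoly I) :
    pderiv i (totalDeriv P) = totalDeriv (pderiv i P) + jetDerivation I i P := by
  have h : ⁅jetDerivation I (i + 1), totalDerivation I⁆ = jetDerivation I i := by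
    refine derivation_ext_C_X (fun f => ?_) fun j => ?_
    · rw [Derivation.commutator_apply, totalDerivation_apply, totalDerivation_apply, totalDeriv_C,
        jetDerivation_succ, jetDerivation_succ, pderiv_C, totalDeriv_zero, pderiv_mul, pderiv_C]
      cases i with
      | zero => rw [jetDerivation_zero, partialU_C, pderiv_X_self]; ring
      | succ i => rw [jetDerivation_succ, pderiv_C, pderiv_X_of_ne (Nat.succ_ne_zero i).symm]; ring
    · rw [Derivation.commutator_apply, totalDerivation_apply, totalDerivation_apply, totalDeriv_X,
        jetDerivation_succ, jetDerivation_succ]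
      have h0 : totalDeriv (pderiv i (X j) : DiffPoly I) = 0 := by
        rcases eq_or_ne j i with rfl | hj
        · rw [pderiv_X_self, ← totalDerivation_apply, Derivation.map_one_eq_zero]
        · rw [pderiv_X_of_ne hj, totalDeriv_zero]
      rw [h0, sub_zero]
      cases i with
      | zero => rw [jetDerivation_zero, partialU_X, pderiv_X_of_ne (Nat.succ_ne_zero j)]
      | succ i =>
        rw [jetDerivation_succ]
        rcases eq_or_ne j i with rfl | hj
        · rw [pderiv_X_self, pderiv_X_self]
        · rw [pderiv_X_of_ne hj, pderiv_X_of_ne (by simpa using hj)]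
  have := congrArg (fun D => D P) h
  rw [Derivation.commutator_apply, totalDerivation_apply, totalDerivation_apply] at this
  rw [← this, jetDerivation_succ, jetDerivation_succ]
  ring

theorem pderiv_eq_zero_of_large (P : DiffPoly I) :
    ∃ N, ∀ i, N ≤ i → pderiv i P = 0 := by
  refine ⟨P.vars.sup id + 1, fun i hi => pderiv_eq_zero_of_notMem_vars fun h => ?_⟩
  have := Finset.le_sup (f := id) h
  simp only [id] at this
  omega

theorem iterate_totalDeriv_zero (n : ℕ) : totalDeriv^[n] (0 : DiffPoly I) = 0 :=
  Function.iterate_fixed totalDeriv_zero n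

theorem iterate_totalDeriv_add (n : ℕ) (P Q : DiffPoly I) :
    totalDeriv^[n] (P + Q) = totalDeriv^[n] P + totalDeriv^[n] Q := by
  induction n generalizing P Q with
  | zero => rfl
  | succ n ih => simp only [Function.iterate_succ_apply, totalDeriv_add, ih]

/-- A range independent of `P.vars` lets sums for different polynomials be added and telescoped. -/
theorem varDeriv_eq_sum_of_le {P : DiffPoly I} {N : ℕ} (hN : ∀ i, N ≤ i → pderiv i P = 0) :
    varDeriv P = ∑ k ∈ Finset.range (N + 1), (-1) ^ k * totalDeriv^[k] (jetDerivation I k P) := by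
  classical
  rw [Finset.sum_range_succ', varDeriv, pow_zero, one_mul, Function.iterate_zero_apply,
    jetDerivation_zero, add_comm]
  congr 1
  simp only [jetDerivation_succ]
  have h0 : ∀ i, pderiv i P = 0 →
      (-1 : DiffPoly I) ^ (i + 1) * totalDeriv^[i + 1] (pderiv i P) = 0 := fun i hi => by
    rw [hi, iterate_totalDeriv_zero, mul_zero]
  have e1 := Finset.sum_subset (Finset.subset_union_left (s₁ := P.vars) (s₂ := Finset.range N))
    (f := fun i => (-1 : DiffPoly I) ^ (i + 1) * totalDeriv^[i + 1] (pderiv i P))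
    fun i _ hi => h0 i (pderiv_eq_zero_of_notMem_vars hi)
  have e2 := Finset.sum_subset (Finset.subset_union_right (s₁ := P.vars) (s₂ := Finset.range N))
    (f := fun i => (-1 : DiffPoly I) ^ (i + 1) * totalDeriv^[i + 1] (pderiv i P))
    fun i _ hi => h0 i (hN i (by simpa using hi))
  exact e1.trans e2.symm

theorem varDeriv_add (P Q : DiffPoly I) : varDeriv (P + Q) = varDeriv P + varDeriv Q := by
  obtain ⟨M, hM⟩ := pderiv_eq_zero_of_large P
  obtain ⟨N, hN⟩ := pderiv_eq_zero_of_large Q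
  rw [varDeriv_eq_sum_of_le (N := max M N) fun i hi => hM i (le_of_max_le_left hi),
    varDeriv_eq_sum_of_le (N := max M N) fun i hi => hN i (le_of_max_le_right hi),
    varDeriv_eq_sum_of_le (N := max M N) fun i hi => by
      rw [map_add, hM i (le_of_max_le_left hi), hN i (le_of_max_le_right hi), add_zero],
    ← Finset.sum_add_distrib]
  exact Finset.sum_congr rfl fun k _ => by rw [map_add, iterate_totalDeriv_add, mul_add]

/-- The variational derivative annihilates total derivatives. -/
theorem varDeriv_totalDeriv (R : DiffPoly I) : varDeriv (totalDeriv R) = 0 := by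
  obtain ⟨N, hN⟩ := pderiv_eq_zero_of_large R
  have hz : ∀ k, N < k → jetDerivation I k R = 0 := fun k hk => by
    obtain ⟨i, rfl⟩ := Nat.exists_eq_succ_of_ne_zero (Nat.ne_zero_of_lt hk)
    exact hN i (by omega)
  rw [varDeriv_eq_sum_of_le (N := N + 1) fun i hi => by
    rw [pderiv_totalDeriv, hN i (by omega), totalDeriv_zero, hz i (by omega), add_zero]]
  -- By the commutation rule the alternating sum telescopes to one boundary term, which vanishes
  -- once n exceeds the order of R.
  have key : ∀ n, ∑ k ∈ Finset.range (n + 1),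
      (-1) ^ k * totalDeriv^[k] (jetDerivation I k (totalDeriv R)) =
        (-1) ^ n * totalDeriv^[n + 1] (jetDerivation I n R) := by
    intro n
    induction n with
    | zero =>
      simp [jetDerivation_zero, partialU_totalDeriv]
    | succ n ih =>
      rw [Finset.sum_range_succ, ih, jetDerivation_succ, pderiv_totalDeriv, iterate_totalDeriv_add,
        ← Function.iterate_succ_apply, jetDerivation_succ]
      ring
  rw [key, hz (N + 1) (by omega), iterate_totalDeriv_zero, mul_zero]

theorem SameFunctional.varDeriv_eq {P Q : DiffPoly I} (h : SameFunctional P Q) :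
    varDeriv P = varDeriv Q := by
  obtain ⟨R, hR⟩ := h
  rw [← sub_add_cancel P Q, hR, varDeriv_add, varDeriv_totalDeriv, zero_add]

/-- Integration by parts, iterated. -/
theorem exists_iterate_by_parts (n : ℕ) (P Q : DiffPoly I) :
    ∃ R, (-1) ^ n * totalDeriv^[n] P * Q = P * totalDeriv^[n] Q + totalDeriv R := by
  induction n generalizing P with
  | zero => exact ⟨0, by simp [totalDeriv_zero]⟩
  | succ n ih =>
    obtain ⟨R, hR⟩ := ih (totalDeriv P)
    refine ⟨-R - P * totalDeriv^[n] Q, ?_⟩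
    rw [sub_eq_add_neg, totalDeriv_add, totalDeriv_neg, totalDeriv_neg, totalDeriv_mul,
      Function.iterate_succ_apply, Function.iterate_succ_apply' _ _ Q]
    linear_combination -hR

/-- Translation invariance: `δh/δu · u_x` is a total derivative. -/
theorem exists_varDeriv_mul_X_zero (P : DiffPoly I) :
    ∃ R, varDeriv P * X 0 = totalDeriv R := by
  choose R hR using fun i => exists_iterate_by_parts (i + 1) (pderiv i P) (X 0)
  have hX : ∀ n, totalDeriv^[n] (X 0 : DiffPoly I) = X n := fun n => by
    induction n with
    | zero => rfl
    | succ n ih => rw [Function.iterate_succ_apply', ih, totalDeriv_X]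
  -- Integrating by parts leaves the sum of ∂P/∂u^(k) · u^(k+1), which is ∂ₓP by the chain rule;
  -- hence the summand P.
  refine ⟨P + ∑ i ∈ P.vars, R i, ?_⟩
  rw [totalDeriv_add, ← totalDerivation_apply (∑ i ∈ P.vars, R i), map_sum, varDeriv, add_mul,
    Finset.sum_mul]
  simp only [hR, hX, totalDerivation_apply, Finset.sum_add_distrib]
  rw [totalDeriv]
  simp only [mul_comm]
  ring

/-! ### Expansion at a constant to first order in each of three exponentials -/

/-- The algebra `ℂ[s₁, s₂, s₃] / (s₁², s₂², s₃²)`: the fields are the coefficients of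
`1, s₁, s₂, s₃, s₁ s₂, s₁ s₃, s₂ s₃, s₁ s₂ s₃`. -/
@[ext]
structure TripleJet where
  c₀ : ℂ
  c₁ : ℂ
  c₂ : ℂ
  c₃ : ℂ
  c₁₂ : ℂ
  c₁₃ : ℂ
  c₂₃ : ℂ
  top : ℂ

namespace TripleJet

instance : Zero TripleJet := ⟨⟨0, 0, 0, 0, 0, 0, 0, 0⟩⟩

instance : One TripleJet := ⟨⟨1, 0, 0, 0, 0, 0, 0, 0⟩⟩

instance : Add TripleJet :=
  ⟨fun x y => ⟨x.c₀ + y.c₀, x.c₁ + y.c₁, x.c₂ + y.c₂, x.c₃ + y.c₃, x.c₁₂ + y.c₁₂, x.c₁₃ + y.c₁₃,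
    x.c₂₃ + y.c₂₃, x.top + y.top⟩⟩

instance : Neg TripleJet :=
  ⟨fun x => ⟨-x.c₀, -x.c₁, -x.c₂, -x.c₃, -x.c₁₂, -x.c₁₃, -x.c₂₃, -x.top⟩⟩

instance : Mul TripleJet :=
  ⟨fun x y => ⟨x.c₀ * y.c₀, x.c₀ * y.c₁ + x.c₁ * y.c₀, x.c₀ * y.c₂ + x.c₂ * y.c₀,
    x.c₀ * y.c₃ + x.c₃ * y.c₀, x.c₀ * y.c₁₂ + x.c₁ * y.c₂ + x.c₂ * y.c₁ + x.c₁₂ * y.c₀,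
    x.c₀ * y.c₁₃ + x.c₁ * y.c₃ + x.c₃ * y.c₁ + x.c₁₃ * y.c₀,
    x.c₀ * y.c₂₃ + x.c₂ * y.c₃ + x.c₃ * y.c₂ + x.c₂₃ * y.c₀,
    x.c₀ * y.top + x.c₁ * y.c₂₃ + x.c₂ * y.c₁₃ + x.c₃ * y.c₁₂ + x.c₁₂ * y.c₃ + x.c₁₃ * y.c₂ +
      x.c₂₃ * y.c₁ + x.top * y.c₀⟩⟩

theorem mk_add_mk (a a₁ a₂ a₃ a₁₂ a₁₃ a₂₃ a₁₂₃ b b₁ b₂ b₃ b₁₂ b₁₃ b₂₃ b₁₂₃ : ℂ) :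
    mk a a₁ a₂ a₃ a₁₂ a₁₃ a₂₃ a₁₂₃ + mk b b₁ b₂ b₃ b₁₂ b₁₃ b₂₃ b₁₂₃ =
      mk (a + b) (a₁ + b₁) (a₂ + b₂) (a₃ + b₃) (a₁₂ + b₁₂) (a₁₃ + b₁₃) (a₂₃ + b₂₃)
        (a₁₂₃ + b₁₂₃) := rfl

theorem neg_mk (a a₁ a₂ a₃ a₁₂ a₁₃ a₂₃ a₁₂₃ : ℂ) :
    -mk a a₁ a₂ a₃ a₁₂ a₁₃ a₂₃ a₁₂₃ = mk (-a) (-a₁) (-a₂) (-a₃) (-a₁₂) (-a₁₃) (-a₂₃) (-a₁₂₃) :=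
  rfl

theorem mk_mul_mk (a a₁ a₂ a₃ a₁₂ a₁₃ a₂₃ a₁₂₃ b b₁ b₂ b₃ b₁₂ b₁₃ b₂₃ b₁₂₃ : ℂ) :
    mk a a₁ a₂ a₃ a₁₂ a₁₃ a₂₃ a₁₂₃ * mk b b₁ b₂ b₃ b₁₂ b₁₃ b₂₃ b₁₂₃ =
      mk (a * b) (a * b₁ + a₁ * b) (a * b₂ + a₂ * b) (a * b₃ + a₃ * b)
        (a * b₁₂ + a₁ * b₂ + a₂ * b₁ + a₁₂ * b) (a * b₁₃ + a₁ * b₃ + a₃ * b₁ + a₁₃ * b)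
        (a * b₂₃ + a₂ * b₃ + a₃ * b₂ + a₂₃ * b)
        (a * b₁₂₃ + a₁ * b₂₃ + a₂ * b₁₃ + a₃ * b₁₂ + a₁₂ * b₃ + a₁₃ * b₂ + a₂₃ * b₁ +
          a₁₂₃ * b) := rfl

theorem mk_zero : mk 0 0 0 0 0 0 0 0 = 0 := rfl

theorem mk_one : mk 1 0 0 0 0 0 0 0 = 1 := rfl

instance : CommRing TripleJet where
  add_assoc x y z := by cases x; cases y; cases z; simp only [mk_add_mk, add_assoc]
  zero_add x := by cases x; simp only [← mk_zero, mk_add_mk, zero_add]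
  add_zero x := by cases x; simp only [← mk_zero, mk_add_mk, add_zero]
  add_comm x y := by cases x; cases y; simp only [mk_add_mk, add_comm]
  neg_add_cancel x := by cases x; simp only [← mk_zero, neg_mk, mk_add_mk, neg_add_cancel]
  nsmul := nsmulRec
  zsmul := zsmulRec
  mul_assoc x y z := by
    cases x; cases y; cases z
    simp only [mk_mul_mk]
    congr 1 <;> ring
  mul_comm x y := by
    cases x; cases y
    simp only [mk_mul_mk]
    congr 1 <;> ring
  one_mul x := by cases x; simp only [← mk_one, mk_mul_mk, one_mul, zero_mul, add_zero]
  mul_one x := by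
    cases x
    simp only [← mk_one, mk_mul_mk, mul_one, mul_zero, zero_add]
  zero_mul x := by cases x; simp only [← mk_zero, mk_mul_mk, zero_mul, add_zero]
  mul_zero x := by cases x; simp only [← mk_zero, mk_mul_mk, mul_zero, add_zero]
  left_distrib x y z := by
    cases x; cases y; cases z
    simp only [mk_add_mk, mk_mul_mk]
    congr 1 <;> ring
  right_distrib x y z := by
    cases x; cases y; cases z
    simp only [mk_add_mk, mk_mul_mk]
    congr 1 <;> ring

theorem top_add (x y : TripleJet) : top (x + y) = top x + top y := rfl

/-- The derivation of `TripleJet` with `sᵢ ↦ ξᵢ sᵢ`. -/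
def deriv (ξ₁ ξ₂ ξ₃ : ℂ) (x : TripleJet) : TripleJet :=
  mk 0 (ξ₁ * x.c₁) (ξ₂ * x.c₂) (ξ₃ * x.c₃) ((ξ₁ + ξ₂) * x.c₁₂) ((ξ₁ + ξ₃) * x.c₁₃)
    ((ξ₂ + ξ₃) * x.c₂₃) ((ξ₁ + ξ₂ + ξ₃) * x.top)

theorem deriv_mk (ξ₁ ξ₂ ξ₃ a a₁ a₂ a₃ a₁₂ a₁₃ a₂₃ a₁₂₃ : ℂ) :
    deriv ξ₁ ξ₂ ξ₃ (mk a a₁ a₂ a₃ a₁₂ a₁₃ a₂₃ a₁₂₃) =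
      mk 0 (ξ₁ * a₁) (ξ₂ * a₂) (ξ₃ * a₃) ((ξ₁ + ξ₂) * a₁₂) ((ξ₁ + ξ₃) * a₁₃)
        ((ξ₂ + ξ₃) * a₂₃) ((ξ₁ + ξ₂ + ξ₃) * a₁₂₃) := rfl

theorem deriv_add (ξ₁ ξ₂ ξ₃ : ℂ) (x y : TripleJet) :
    deriv ξ₁ ξ₂ ξ₃ (x + y) = deriv ξ₁ ξ₂ ξ₃ x + deriv ξ₁ ξ₂ ξ₃ y := by
  cases x; cases y
  simp only [mk_add_mk, deriv_mk]
  congr 1 <;> ring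

theorem deriv_mul (ξ₁ ξ₂ ξ₃ : ℂ) (x y : TripleJet) :
    deriv ξ₁ ξ₂ ξ₃ (x * y) = x * deriv ξ₁ ξ₂ ξ₃ y + y * deriv ξ₁ ξ₂ ξ₃ x := by
  cases x; cases y
  simp only [mk_add_mk, mk_mul_mk, deriv_mk]
  congr 1 <;> ring

/-- The monomial s₁s₂s₃ is an eigenvector whose eigenvalue is the total frequency. At resonance the
top coefficient therefore descends to functionals. -/
theorem top_deriv {ξ₁ ξ₂ ξ₃ : ℂ} (h : ξ₁ + ξ₂ + ξ₃ = 0) (x : TripleJet) :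
    top (deriv ξ₁ ξ₂ ξ₃ x) = 0 := by
  change (ξ₁ + ξ₂ + ξ₃) * _ = 0
  rw [h, zero_mul]

/-- The Taylor expansion `f ↦ e(f) + e(D f) s + e(D² f) s² / 2 + e(D³ f) s³ / 6` with
`s = s₁ + s₂ + s₃`. -/
def taylor {S : Type*} [CommRing S] (D : S → S) (hadd : ∀ f g, D (f + g) = D f + D g)
    (hmul : ∀ f g, D (f * g) = f * D g + g * D f) (e : S →+* ℂ) : S →+* TripleJet where
  toFun f := mk (e f) (e (D f)) (e (D f)) (e (D f)) (e (D (D f))) (e (D (D f))) (e (D (D f)))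
    (e (D (D (D f))))
  map_zero' := by
    have h0 : D 0 = 0 := by simpa using hadd 0 0
    simp only [h0, map_zero, mk_zero]
  map_one' := by
    have h0 : D 0 = 0 := by simpa using hadd 0 0
    have h1 : D 1 = 0 := by simpa using hmul 1 1
    simp only [h1, h0, map_zero, map_one, mk_one]
  map_add' f g := by simp only [hadd, map_add, mk_add_mk]
  map_mul' f g := by
    simp only [hmul, hadd, map_add, map_mul, mk_mul_mk]
    congr 1 <;> ring

end TripleJet

/-- The value of a smooth function at a point, as a complex number. -/
def evalAt (x : I) : SmoothFun I →+* ℂ :=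
  (Complex.ofRealHom.comp (Pi.evalRingHom (fun _ : I => ℝ) x)).comp (SmoothFun I).toSubring.subtype

/-- Expansion of a differential polynomial at the constant `x`, for
`u = x + s₁ exp (ξ₁ t) + s₂ exp (ξ₂ t) + s₃ exp (ξ₃ t)`. -/
def expand (x : I) (ξ₁ ξ₂ ξ₃ : ℂ) : DiffPoly I →+* TripleJet :=
  eval₂Hom (TripleJet.taylor (derivU I) (map_add _)
      (fun f g => by rw [Derivation.leibniz, smul_eq_mul, smul_eq_mul]) (evalAt x))
    fun i => TripleJet.mk 0 (ξ₁ ^ (i + 1)) (ξ₂ ^ (i + 1)) (ξ₃ ^ (i + 1)) 0 0 0 0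

variable (x : I) (ξ₁ ξ₂ ξ₃ : ℂ)

theorem expand_C (f : SmoothFun I) : expand x ξ₁ ξ₂ ξ₃ (C f) =
    TripleJet.mk (evalAt x f) (evalAt x (derivU I f)) (evalAt x (derivU I f))
      (evalAt x (derivU I f)) (evalAt x (derivU I (derivU I f)))
      (evalAt x (derivU I (derivU I f))) (evalAt x (derivU I (derivU I f)))
      (evalAt x (derivU I (derivU I (derivU I f)))) :=
  eval₂Hom_C _ _ _

theorem expand_X (i : ℕ) : expand x ξ₁ ξ₂ ξ₃ (X i) =
    TripleJet.mk 0 (ξ₁ ^ (i + 1)) (ξ₂ ^ (i + 1)) (ξ₃ ^ (i + 1)) 0 0 0 0 :=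
  eval₂Hom_X' _ _ _

/-- The chain rule: expansion turns ∂ₓ into differentiation of the exponentials in t. -/
theorem expand_totalDeriv (P : DiffPoly I) : expand x ξ₁ ξ₂ ξ₃ (totalDeriv P) =
    TripleJet.deriv ξ₁ ξ₂ ξ₃ (expand x ξ₁ ξ₂ ξ₃ P) := by
  induction P using MvPolynomial.induction_on with
  | C f =>
    rw [totalDeriv_C, map_mul, expand_X, expand_C, expand_C, TripleJet.mk_mul_mk,
      TripleJet.deriv_mk]
    congr 1 <;> ring
  | add P Q hP hQ => rw [totalDeriv_add, map_add, map_add, TripleJet.deriv_add, hP, hQ]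
  | mul_X P i hP =>
    rw [totalDeriv_mul, map_add, map_mul, map_mul, map_mul, TripleJet.deriv_mul, hP, totalDeriv_X,
      expand_X, expand_X, TripleJet.deriv_mk]
    congr 3
    · ring
    · ring
    · ring
    all_goals ring

theorem c₀_expand (P : DiffPoly I) :
    (expand x ξ₁ ξ₂ ξ₃ P).c₀ = evalAt x (constantCoeff P) := by
  induction P using MvPolynomial.induction_on with
  | C f => rw [expand_C, constantCoeff_C]
  | add P Q hP hQ => rw [map_add, map_add, map_add, ← hP, ← hQ]; rfl
  | mul_X P i hP =>
    rw [map_mul, map_mul, constantCoeff_X, mul_zero, map_zero, expand_X]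
    exact mul_zero _

variable {x ξ₁ ξ₂ ξ₃}

/-- Total derivatives have no resonant cubic part. -/
theorem SameFunctional.top_expand (hξ : ξ₁ + ξ₂ + ξ₃ = 0) {P : DiffPoly I}
    (h : SameFunctional P 0) : (expand x ξ₁ ξ₂ ξ₃ P).top = 0 := by
  obtain ⟨R, hR⟩ := h
  rw [sub_zero] at hR
  rw [hR, expand_totalDeriv, TripleJet.top_deriv hξ]

/-! ### The quadratic part of a functional at a constant -/

theorem jetDerivation_C_zero (f : SmoothFun I) : jetDerivation I 0 (C f) = C (derivU I f) :=
  partialU_C f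

theorem jetDerivation_C_succ (k : ℕ) (f : SmoothFun I) : jetDerivation I (k + 1) (C f) = 0 :=
  pderiv_C

theorem jetDerivation_X (k i : ℕ) :
    jetDerivation I k (X i) = C (if k = i + 1 then 1 else 0) := by
  cases k with
  | zero => rw [jetDerivation_zero, partialU_X, if_neg (Nat.succ_ne_zero i).symm, map_zero]
  | succ k =>
    rw [jetDerivation_succ]
    rcases eq_or_ne i k with rfl | h
    · rw [pderiv_X_self, if_pos rfl, map_one]
    · rw [pderiv_X_of_ne h, if_neg (by simpa using h.symm), map_zero]

theorem jetDerivation_comm (k l : ℕ) (P : DiffPoly I) :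
    jetDerivation I k (jetDerivation I l P) = jetDerivation I l (jetDerivation I k P) := by
  have hc : ∀ (k l i : ℕ), jetDerivation I k (jetDerivation I l (X i)) = 0 := fun k l i => by
    have h : derivU I (if l = i + 1 then 1 else 0) = 0 := by split_ifs <;> simp
    rw [jetDerivation_X]
    cases k with
    | zero => rw [jetDerivation_C_zero, h, map_zero]
    | succ k => rw [jetDerivation_C_succ]
  have h : ⁅jetDerivation I k, jetDerivation I l⁆ = 0 := by
    refine derivation_ext_C_X (fun f => ?_) fun i => ?_
    · rw [Derivation.commutator_apply]
      cases k <;> cases l <;>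
        simp only [jetDerivation_C_zero, jetDerivation_C_succ, map_zero, sub_self,
          Derivation.zero_apply]
    · rw [Derivation.commutator_apply, hc, hc, sub_zero, Derivation.zero_apply]
  have := congrArg (fun D => D P) h
  rw [Derivation.commutator_apply] at this
  exact sub_eq_zero.1 this

/-- Homogeneity of degree `n` for the grading `deg u^{(k)} = k`. -/
abbrev IsHomogeneousOfDegree (P : DiffPoly I) (n : ℕ) : Prop :=
  IsWeightedHomogeneous (fun i : ℕ => i + 1) P n

theorem IsHomogeneousOfDegree.constantCoeff_eq_zero {P : DiffPoly I} {n : ℕ}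
    (hP : IsHomogeneousOfDegree P n) (hn : n ≠ 0) : constantCoeff P = 0 := by
  rw [constantCoeff_eq]
  exact hP.coeff_eq_zero 0 (by simpa using hn.symm)

theorem IsHomogeneousOfDegree.pderiv_eq_zero {P : DiffPoly I} {n i : ℕ}
    (hP : IsHomogeneousOfDegree P n) (hi : n ≤ i) : pderiv i P = 0 := by
  ext1 m
  rw [coeff_pderiv, hP.coeff_eq_zero, zero_mul, coeff_zero]
  rw [map_add, Finsupp.weight_single]
  simp only [smul_eq_mul, one_mul]
  omega

theorem IsHomogeneousOfDegree.jetDerivation {P : DiffPoly I} {n n' k : ℕ}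
    (hP : IsHomogeneousOfDegree P n) (hk : n' + k = n) :
    IsHomogeneousOfDegree (jetDerivation I k P) n' := by
  cases k with
  | zero =>
    intro m hm
    rw [jetDerivation_zero, coeff_partialU] at hm
    rw [add_zero] at hk
    rw [hk]
    exact hP fun h => hm (by rw [h, map_zero])
  | succ k => exact IsWeightedHomogeneous.pderiv hP hk

/-- The functional `L` on differential polynomials is the coefficient of `s` in the expansion at
`u = x + s exp (ξ t)`. -/
structure IsLinearPart (x : I) (ξ : ℂ) (L : DiffPoly I → ℂ) : Prop where
  add : ∀ P Q, L (P + Q) = L P + L Q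
  C : ∀ f, L (C f) = evalAt x (derivU I f)
  mul_X : ∀ P i, L (P * X i) = evalAt x (constantCoeff P) * ξ ^ (i + 1)
  totalDeriv : ∀ P, L (totalDeriv P) = ξ * L P

namespace IsLinearPart

variable {x : I} {ξ : ℂ} {L : DiffPoly I → ℂ}

theorem eventually_eq_sum (hL : IsLinearPart x ξ L) (P : DiffPoly I) :
    ∀ᶠ N in Filter.atTop, L P =
      ∑ l ∈ Finset.range N, ξ ^ l * evalAt x (constantCoeff (jetDerivation I l P)) := by
  induction P using MvPolynomial.induction_on with
  | C f =>
    filter_upwards [Filter.eventually_ge_atTop 1] with N hN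
    obtain ⟨N, rfl⟩ := Nat.exists_eq_add_of_le' hN
    rw [Finset.sum_range_succ', hL.C, jetDerivation_C_zero]
    simp [jetDerivation_C_succ]
  | add P Q hP hQ =>
    filter_upwards [hP, hQ] with N hP hQ
    rw [hL.add, hP, hQ, ← Finset.sum_add_distrib]
    exact Finset.sum_congr rfl fun l _ => by rw [map_add, map_add, map_add, mul_add]
  | mul_X P i _ =>
    filter_upwards [Filter.eventually_ge_atTop (i + 2)] with N hN
    rw [hL.mul_X, Finset.sum_eq_single (i + 1)]
    · rw [Derivation.leibniz, jetDerivation_X, if_pos rfl, smul_eq_mul, smul_eq_mul, map_add,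
        map_mul, map_mul, constantCoeff_X, constantCoeff_C, zero_mul, add_zero, mul_one, mul_comm]
    · intro l _ hl
      rw [Derivation.leibniz, jetDerivation_X, if_neg hl, smul_eq_mul, smul_eq_mul, map_add,
        map_mul, map_mul, constantCoeff_X, constantCoeff_C, zero_mul, mul_zero, add_zero, map_zero,
        mul_zero]
    · intro h
      simp only [Finset.mem_range] at h
      omega

/-- Only ∂P/∂u^(n) can have a constant term: lower derivatives keep positive degree and higher ones
vanish. -/
theorem eq_of_isHomogeneous (hL : IsLinearPart x ξ L) {P : DiffPoly I} {n : ℕ}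
    (hP : IsHomogeneousOfDegree P n) :
    L P = ξ ^ n * evalAt x (constantCoeff (jetDerivation I n P)) := by
  obtain ⟨N, hN, hn⟩ := ((hL.eventually_eq_sum P).and (Filter.eventually_gt_atTop n)).exists
  rw [hN]
  refine Finset.sum_eq_single n (fun l _ hl => ?_) fun h => absurd (Finset.mem_range.2 hn) h
  rcases lt_or_gt_of_ne hl with h | h
  · rw [(hP.jetDerivation (n' := n - l) (by omega)).constantCoeff_eq_zero (by omega), map_zero,
      mul_zero]
  · obtain ⟨l, rfl⟩ := Nat.exists_eq_succ_of_ne_zero (Nat.ne_zero_of_lt h)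
    rw [Nat.succ_eq_add_one, jetDerivation_succ, hP.pderiv_eq_zero (by omega), map_zero, map_zero,
      mul_zero]

theorem iterate_totalDeriv (hL : IsLinearPart x ξ L) (k : ℕ) (P : DiffPoly I) :
    L (HopfPerturbation.totalDeriv^[k] P) = ξ ^ k * L P := by
  induction k with
  | zero => simp
  | succ k ih => rw [Function.iterate_succ_apply', hL.totalDeriv, ih, pow_succ']; ring

end IsLinearPart

/-- The dispersion coefficient at `x` of a functional whose density is homogeneous of degree `n`. -/
def dispersionCoeff (x : I) (n : ℕ) (P : DiffPoly I) : ℂ :=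
  ∑ k ∈ Finset.range (n + 1),
    (-1) ^ k * evalAt x (constantCoeff (jetDerivation I (n - k) (jetDerivation I k P)))

/-- The reflection k ↦ n - k preserves the mixed second derivatives and multiplies the sign by
(-1)ⁿ. Equivalently, the linearized variational derivative is formally self-adjoint, so its symbol
is even. -/
theorem dispersionCoeff_eq_zero_of_odd (x : I) {n : ℕ} (hn : Odd n) (P : DiffPoly I) :
    dispersionCoeff x n P = 0 := by
  have h : dispersionCoeff x n P = -dispersionCoeff x n P := by
    conv_lhs => rw [dispersionCoeff, ← Finset.sum_range_reflect]
    rw [dispersionCoeff, ← Finset.sum_neg_distrib]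
    refine Finset.sum_congr rfl fun k hk => ?_
    have hk : k ≤ n := by simpa [Nat.lt_succ_iff] using hk
    rw [jetDerivation_comm, show n + 1 - 1 - k = n - k by omega, show n - (n - k) = k by omega,
      jetDerivation_comm, ← neg_mul]
    congr 1
    have h1 : (-1 : ℂ) ^ (n - k) * (-1) ^ k = -1 := by
      rw [← pow_add, Nat.sub_add_cancel hk, hn.neg_one_pow]
    have h2 : (-1 : ℂ) ^ k * (-1) ^ k = 1 := by rw [← mul_pow]; simp
    linear_combination (-1 : ℂ) ^ k * h1 - (-1) ^ (n - k) * h2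
  exact self_eq_neg.1 h

theorem IsLinearPart.varDeriv {x : I} {ξ : ℂ} {L : DiffPoly I → ℂ} (hL : IsLinearPart x ξ L)
    {P : DiffPoly I} {n : ℕ} (hP : IsHomogeneousOfDegree P n) :
    L (varDeriv P) = dispersionCoeff x n P * ξ ^ n := by
  let L' : DiffPoly I →+ ℂ := AddMonoidHom.mk' L hL.add
  have hneg : ∀ (k : ℕ) (Q : DiffPoly I), L ((-1) ^ k * Q) = (-1) ^ k * L Q := fun k Q => by
    rcases Nat.even_or_odd k with hk | hk
    · rw [hk.neg_one_pow, hk.neg_one_pow, one_mul, one_mul]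
    · rw [hk.neg_one_pow, hk.neg_one_pow, neg_one_mul, neg_one_mul]
      exact map_neg L' Q
  rw [varDeriv_eq_sum_of_le fun i hi => hP.pderiv_eq_zero hi, dispersionCoeff, Finset.sum_mul]
  refine (map_sum L' _ _).trans (Finset.sum_congr rfl fun k hk => ?_)
  have hk : k ≤ n := by simpa [Nat.lt_succ_iff] using hk
  change L _ = _
  rw [hneg, hL.iterate_totalDeriv,
    hL.eq_of_isHomogeneous (hP.jetDerivation (n' := n - k) (by omega))]
  have : ξ ^ n = ξ ^ k * ξ ^ (n - k) := by rw [← pow_add, Nat.add_sub_cancel' hk]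
  rw [this]
  ring

variable (x : I) (ξ₁ ξ₂ ξ₃ : ℂ)

theorem isLinearPart_c₁ : IsLinearPart x ξ₁ fun P => (expand x ξ₁ ξ₂ ξ₃ P).c₁ where
  add P Q := by rw [map_add]; rfl
  C f := by rw [expand_C]
  mul_X P i := by
    rw [map_mul, expand_X, ← c₀_expand x ξ₁ ξ₂ ξ₃ P]
    cases expand x ξ₁ ξ₂ ξ₃ P
    simp only [TripleJet.mk_mul_mk]
    ring
  totalDeriv P := by rw [expand_totalDeriv]; rfl

theorem isLinearPart_c₂ : IsLinearPart x ξ₂ fun P => (expand x ξ₁ ξ₂ ξ₃ P).c₂ where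
  add P Q := by rw [map_add]; rfl
  C f := by rw [expand_C]
  mul_X P i := by
    rw [map_mul, expand_X, ← c₀_expand x ξ₁ ξ₂ ξ₃ P]
    cases expand x ξ₁ ξ₂ ξ₃ P
    simp only [TripleJet.mk_mul_mk]
    ring
  totalDeriv P := by rw [expand_totalDeriv]; rfl

theorem isLinearPart_c₃ : IsLinearPart x ξ₃ fun P => (expand x ξ₁ ξ₂ ξ₃ P).c₃ where
  add P Q := by rw [map_add]; rfl
  C f := by rw [expand_C]
  mul_X P i := by
    rw [map_mul, expand_X, ← c₀_expand x ξ₁ ξ₂ ξ₃ P]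
    cases expand x ξ₁ ξ₂ ξ₃ P
    simp only [TripleJet.mk_mul_mk]
    ring
  totalDeriv P := by rw [expand_totalDeriv]; rfl

variable {x ξ₁ ξ₂ ξ₃}

theorem c₀_expand_varDeriv {P : DiffPoly I} {n : ℕ} (hP : IsHomogeneousOfDegree P n)
    (hn : n ≠ 0) : (expand x ξ₁ ξ₂ ξ₃ (varDeriv P)).c₀ = 0 := by
  let L : DiffPoly I →+ ℂ := AddMonoidHom.mk' (fun P => (expand x ξ₁ ξ₂ ξ₃ P).c₀)
    fun P Q => by rw [map_add]; rfl
  have h0 : (expand x ξ₁ ξ₂ ξ₃ (partialU P)).c₀ = 0 := by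
    rw [c₀_expand, ← jetDerivation_zero, (hP.jetDerivation (add_zero n)).constantCoeff_eq_zero hn,
      map_zero]
  have h1 : L (varDeriv P) = 0 := by
    rw [varDeriv, map_add, map_sum, Finset.sum_eq_zero, add_zero]
    · exact h0
    · intro i _
      change (expand x ξ₁ ξ₂ ξ₃ _).c₀ = 0
      rw [Function.iterate_succ_apply', map_mul, expand_totalDeriv]
      exact mul_zero _
  exact h1

/-- The expansion of a variational derivative to first order. -/
theorem expand_varDeriv {P : DiffPoly I} {n : ℕ} (hP : IsHomogeneousOfDegree P n) (hn : n ≠ 0)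
    (x : I) (ξ₁ ξ₂ ξ₃ : ℂ) : ∃ a₁₂ a₁₃ a₂₃ a, expand x ξ₁ ξ₂ ξ₃ (varDeriv P) =
      ⟨0, dispersionCoeff x n P * ξ₁ ^ n, dispersionCoeff x n P * ξ₂ ^ n,
        dispersionCoeff x n P * ξ₃ ^ n, a₁₂, a₁₃, a₂₃, a⟩ :=
  ⟨_, _, _, _, TripleJet.ext (c₀_expand_varDeriv hP hn) ((isLinearPart_c₁ x ξ₁ ξ₂ ξ₃).varDeriv hP)
    ((isLinearPart_c₂ x ξ₁ ξ₂ ξ₃).varDeriv hP) ((isLinearPart_c₃ x ξ₁ ξ₂ ξ₃).varDeriv hP)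
    rfl rfl rfl rfl⟩

/-! ### Normal forms of functionals of low degree -/

/-- Reduces the list of monomials of a given degree to a linear equation in finitely many exponents.
-/
theorem monomial_eq_of_weight_eq {n : ℕ} {d : ℕ →₀ ℕ}
    (hd : Finsupp.weight (fun i : ℕ => i + 1) d = n) (r : SmoothFun I) :
    (monomial d r : DiffPoly I) = C r * ∏ i ∈ Finset.range n, X i ^ d i ∧
      ∑ i ∈ Finset.range n, d i * (i + 1) = n := by
  have hs : d.support ⊆ Finset.range n := fun i hi => by
    have h0 : (fun i : ℕ => i + 1) i ≤ Finsupp.weight (fun i : ℕ => i + 1) d :=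
      Finsupp.le_weight_of_ne_zero' (fun i : ℕ => i + 1) (Finsupp.mem_support_iff.1 hi)
    rw [hd] at h0
    exact Finset.mem_range.2 h0
  constructor
  · rw [monomial_eq, Finsupp.prod_of_support_subset _ hs _ fun i _ => pow_zero _]
  · rw [Finsupp.weight_apply, Finsupp.sum_of_support_subset _ hs _ (by simp)] at hd
    simpa only [smul_eq_mul] using hd

theorem exists_normal_form_two {P : DiffPoly I} (hP : IsHomogeneousOfDegree P 2) :
    ∃ q : SmoothFun I, varDeriv P = varDeriv (C q * X 0 ^ 2) := by
  suffices h : ∃ (q : SmoothFun I) (R : DiffPoly I), P = C q * X 0 ^ 2 + totalDeriv R by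
    obtain ⟨q, R, h⟩ := h
    exact ⟨q, by rw [h, varDeriv_add, varDeriv_totalDeriv, add_zero]⟩
  induction hP using IsWeightedHomogeneous.induction_on with
  | zero => exact ⟨0, 0, by rw [map_zero, zero_mul, totalDeriv_zero, add_zero]⟩
  | add P Q _ _ hP hQ =>
    obtain ⟨q, R, hP⟩ := hP
    obtain ⟨q', R', hQ⟩ := hQ
    exact ⟨q + q', R + R', by rw [hP, hQ, map_add, totalDeriv_add]; ring⟩
  | monomial d r hd =>
    obtain ⟨h, hs⟩ := monomial_eq_of_weight_eq hd r
    simp only [Finset.sum_range_succ, Finset.sum_range_zero, zero_add] at hs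
    simp only [Finset.prod_range_succ, Finset.prod_range_zero, one_mul] at h
    have : d 1 ≤ 1 := by omega
    obtain ⟨h0, h1⟩ | ⟨h0, h1⟩ : (d 0 = 2 ∧ d 1 = 0) ∨ (d 0 = 0 ∧ d 1 = 1) := by omega
    · exact ⟨r, 0, by rw [h, h0, h1, totalDeriv_zero]; ring⟩
    · refine ⟨-derivU I r, C r * X 0, ?_⟩
      rw [h, h0, h1, totalDeriv_mul, totalDeriv_C, totalDeriv_X, map_neg]
      ring

theorem exists_normal_form_four {P : DiffPoly I} (hP : IsHomogeneousOfDegree P 4) :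
    ∃ q r : SmoothFun I, varDeriv P = varDeriv (C q * X 1 ^ 2 + C r * X 0 ^ 4) := by
  suffices h : ∃ (q r : SmoothFun I) (R : DiffPoly I),
      P = C q * X 1 ^ 2 + C r * X 0 ^ 4 + totalDeriv R by
    obtain ⟨q, r, R, h⟩ := h
    exact ⟨q, r, by rw [h, varDeriv_add, varDeriv_totalDeriv, add_zero]⟩
  have h21 : ∀ a : SmoothFun I, ∃ (q r : SmoothFun I) (R : DiffPoly I),
      C a * (X 0 ^ 2 * X 1) = C q * X 1 ^ 2 + C r * X 0 ^ 4 + totalDeriv R := fun a => by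
    -- Since ∂ₓ(b u_x³) = b' u_x⁴ + 3b u_x² u_xx, the coefficient has to be divided by 3.
    obtain ⟨b, rfl⟩ : ∃ b : SmoothFun I, a = b + b + b :=
      ⟨(1 / 3 : ℝ) • a, by rw [← add_smul, ← add_smul]; norm_num⟩
    refine ⟨0, -derivU I b, C b * (X 0 * (X 0 * X 0)), ?_⟩
    simp only [totalDeriv_mul, totalDeriv_C, totalDeriv_X, map_neg, map_add, map_zero]
    ring
  have h102 : ∀ a : SmoothFun I, ∃ (q r : SmoothFun I) (R : DiffPoly I),
      C a * (X 0 * X 2) = C q * X 1 ^ 2 + C r * X 0 ^ 4 + totalDeriv R := fun a => by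
    obtain ⟨q, r, R, h⟩ := h21 (derivU I a)
    refine ⟨-a - q, -r, C a * (X 0 * X 1) - R, ?_⟩
    rw [sub_eq_add_neg (C a * _), totalDeriv_add, totalDeriv_neg]
    simp only [totalDeriv_mul, totalDeriv_C, totalDeriv_X, map_neg, map_sub]
    linear_combination -h
  induction hP using IsWeightedHomogeneous.induction_on with
  | zero =>
    exact ⟨0, 0, 0, by rw [map_zero, zero_mul, zero_mul, totalDeriv_zero, add_zero, add_zero]⟩
  | add P Q _ _ hP hQ =>
    obtain ⟨q, r, R, hP⟩ := hP
    obtain ⟨q', r', R', hQ⟩ := hQ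
    exact ⟨q + q', r + r', R + R', by rw [hP, hQ, map_add, map_add, totalDeriv_add]; ring⟩
  | monomial d a hd =>
    obtain ⟨h, hs⟩ := monomial_eq_of_weight_eq hd a
    simp only [Finset.sum_range_succ, Finset.sum_range_zero, zero_add] at hs
    simp only [Finset.prod_range_succ, Finset.prod_range_zero, one_mul] at h
    have h3' : d 3 = 0 ∨ d 3 = 1 := by omega
    have h2' : d 2 = 0 ∨ d 2 = 1 := by omega
    -- The cases are the five partitions of 4.
    obtain ⟨h0, h1, h2, h3⟩ | ⟨h0, h1, h2, h3⟩ | ⟨h0, h1, h2, h3⟩ | ⟨h0, h1, h2, h3⟩ |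
        ⟨h0, h1, h2, h3⟩ : (d 0 = 4 ∧ d 1 = 0 ∧ d 2 = 0 ∧ d 3 = 0) ∨
        (d 0 = 2 ∧ d 1 = 1 ∧ d 2 = 0 ∧ d 3 = 0) ∨ (d 0 = 0 ∧ d 1 = 2 ∧ d 2 = 0 ∧ d 3 = 0) ∨
        (d 0 = 1 ∧ d 1 = 0 ∧ d 2 = 1 ∧ d 3 = 0) ∨ (d 0 = 0 ∧ d 1 = 0 ∧ d 2 = 0 ∧ d 3 = 1) := by
      omega
    all_goals simp only [h0, h1, h2, h3, pow_zero, pow_one, mul_one, one_mul] at h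
    · exact ⟨0, a, 0, by rw [h, totalDeriv_zero, map_zero]; ring⟩
    · rw [h]
      exact h21 a
    · exact ⟨a, 0, 0, by rw [h, totalDeriv_zero, map_zero]; ring⟩
    · rw [h]
      exact h102 a
    · obtain ⟨q, r, R, h'⟩ := h102 (derivU I a)
      refine ⟨-q, -r, C a * X 2 - R, ?_⟩
      rw [h, sub_eq_add_neg (C a * _), totalDeriv_add, totalDeriv_neg]
      simp only [totalDeriv_mul, totalDeriv_C, totalDeriv_X, map_neg]
      linear_combination -h'

/-! ### Variational derivatives of the normal forms and their expansions -/

theorem varDeriv_zero : varDeriv (0 : DiffPoly I) = 0 := by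
  simpa only [totalDeriv_zero] using varDeriv_totalDeriv (0 : DiffPoly I)

theorem varDeriv_C (f : SmoothFun I) : varDeriv (C f) = C (derivU I f) := by
  rw [varDeriv, vars_C, Finset.sum_empty, add_zero, partialU_C]

theorem partialU_mul (P Q : DiffPoly I) :
    partialU (P * Q) = P * partialU Q + Q * partialU P :=
  (partialUDerivation I).leibniz P Q

theorem varDeriv_C_mul_X_zero_sq (q : SmoothFun I) :
    varDeriv (C q * X 0 ^ 2) =
      C (derivU I q) * X 0 ^ 2 - totalDeriv ((C q + C q) * X 0) := by
  rw [varDeriv_eq_sum_of_le (N := 1) fun i hi => by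
    rw [pderiv_C_mul, pderiv_pow, pderiv_X_of_ne (by omega), mul_zero, mul_zero]]
  simp only [Finset.sum_range_succ, Finset.sum_range_zero, zero_add, jetDerivation_zero,
    jetDerivation_succ, pow_two, partialU_mul, partialU_C, partialU_X, pderiv_C, pderiv_mul,
    pderiv_X_self, Function.iterate_succ_apply, Function.iterate_zero_apply, pow_zero, pow_one,
    zero_mul, one_mul, mul_one]
  rw [show (C q : DiffPoly I) * (X 0 + X 0) = (C q + C q) * X 0 by ring]
  ring

theorem varDeriv_C_mul_X_zero_pow_four (r : SmoothFun I) :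
    varDeriv (C r * X 0 ^ 4) =
      C (derivU I r) * X 0 ^ 4 - totalDeriv ((C r + C r + C r + C r) * X 0 ^ 3) := by
  rw [varDeriv_eq_sum_of_le (N := 1) fun i hi => by
    rw [pderiv_C_mul, pderiv_pow, pderiv_X_of_ne (by omega), mul_zero, mul_zero]]
  simp only [Finset.sum_range_succ, Finset.sum_range_zero, zero_add, jetDerivation_zero,
    jetDerivation_succ, pow_succ, partialU_mul, partialU_C, partialU_X, pderiv_C, pderiv_mul,
    pderiv_X_self, Function.iterate_succ_apply, Function.iterate_zero_apply, pow_zero, one_mul,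
    zero_mul, mul_one]
  rw [show (C r : DiffPoly I) * (((X 0 + X 0) * X 0 + X 0 * X 0) * X 0 + X 0 * X 0 * X 0) =
    (C r + C r + C r + C r) * (X 0 * X 0 * X 0) by ring]
  ring

theorem varDeriv_C_mul_X_one_sq (q : SmoothFun I) :
    varDeriv (C q * X 1 ^ 2) =
      C (derivU I q) * X 1 ^ 2 + totalDeriv (totalDeriv ((C q + C q) * X 1)) := by
  rw [varDeriv_eq_sum_of_le (N := 2) fun i hi => by
    rw [pderiv_C_mul, pderiv_pow, pderiv_X_of_ne (by omega), mul_zero, mul_zero]]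
  simp only [Finset.sum_range_succ, Finset.sum_range_zero, zero_add, jetDerivation_zero,
    jetDerivation_succ, pow_two, partialU_mul, partialU_C, partialU_X, pderiv_C, pderiv_mul,
    pderiv_X_self, pderiv_X_of_ne (show (1 : ℕ) ≠ 0 by decide), Function.iterate_succ_apply,
    Function.iterate_zero_apply, pow_zero, pow_one, mul_zero, zero_mul, add_zero,
    totalDeriv_zero, one_mul, mul_one]
  rw [show (C q : DiffPoly I) * (X 1 + X 1) = (C q + C q) * X 1 by ring]
  ring

section Expansion

variable (x : I) (ξ₁ ξ₂ ξ₃ : ℂ)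

theorem c₁_expand_varDeriv_X_zero_sq (q : SmoothFun I) :
    (expand x ξ₁ ξ₂ ξ₃ (varDeriv (C q * X 0 ^ 2))).c₁ = -(2 * evalAt x q) * ξ₁ ^ 2 := by
  rw [varDeriv_C_mul_X_zero_sq]
  simp only [map_neg, map_mul, map_add, expand_totalDeriv, expand_C, expand_X, pow_two,
    sub_eq_add_neg, TripleJet.mk_add_mk, TripleJet.mk_mul_mk, TripleJet.deriv_mk,
    TripleJet.neg_mk]
  ring

/-- The term r u_x⁴ first contributes at cubic order, so r is confined to t. On ξ₁ + ξ₂ + ξ₃ = 0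
each factor ξᵢ² + ξᵢξⱼ + ξⱼ² equals -(ξ₁ξ₂ + ξ₁ξ₃ + ξ₂ξ₃), which is why the bracket below factors.
-/
theorem expand_varDeriv_normal_form_four (q r : SmoothFun I) :
    ∃ t, expand x ξ₁ ξ₂ ξ₃ (varDeriv (C q * X 1 ^ 2 + C r * X 0 ^ 4)) =
      ⟨0, 2 * evalAt x q * ξ₁ ^ 4, 2 * evalAt x q * ξ₂ ^ 4, 2 * evalAt x q * ξ₃ ^ 4,
        2 * evalAt x (derivU I q) * (ξ₁ ^ 2 + ξ₁ * ξ₂ + ξ₂ ^ 2) ^ 2,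
        2 * evalAt x (derivU I q) * (ξ₁ ^ 2 + ξ₁ * ξ₃ + ξ₃ ^ 2) ^ 2,
        2 * evalAt x (derivU I q) * (ξ₂ ^ 2 + ξ₂ * ξ₃ + ξ₃ ^ 2) ^ 2, t⟩ := by
  refine ⟨_, TripleJet.ext ?_ ?_ ?_ ?_ ?_ ?_ ?_ rfl⟩
  all_goals
    rw [varDeriv_add, varDeriv_C_mul_X_one_sq, varDeriv_C_mul_X_zero_pow_four]
    simp only [map_neg, map_mul, map_add, expand_totalDeriv, expand_C, expand_X, pow_succ,
      pow_zero, one_mul, sub_eq_add_neg, TripleJet.mk_add_mk, TripleJet.mk_mul_mk,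
      TripleJet.deriv_mk, TripleJet.neg_mk]
    ring

end Expansion

/-! ### The resonant cubic part of a bracket -/

section Bracket

variable {x : I} {ξ₁ ξ₂ ξ₃ : ℂ}

theorem expand_bracket (P Q : DiffPoly I) : expand x ξ₁ ξ₂ ξ₃ (bracket P Q) =
    expand x ξ₁ ξ₂ ξ₃ (varDeriv P) * TripleJet.deriv ξ₁ ξ₂ ξ₃ (expand x ξ₁ ξ₂ ξ₃ (varDeriv Q)) := by
  rw [bracket, map_mul, expand_totalDeriv]

/-- The two brackets add up to the derivative of a product, which is invisible to the top
coefficient at resonance. -/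
theorem top_expand_bracket_comm (hξ : ξ₁ + ξ₂ + ξ₃ = 0) (P Q : DiffPoly I) :
    (expand x ξ₁ ξ₂ ξ₃ (bracket P Q)).top = -(expand x ξ₁ ξ₂ ξ₃ (bracket Q P)).top := by
  have h := TripleJet.top_deriv hξ
    (expand x ξ₁ ξ₂ ξ₃ (varDeriv P) * expand x ξ₁ ξ₂ ξ₃ (varDeriv Q))
  rw [TripleJet.deriv_mul, TripleJet.top_add] at h
  rw [expand_bracket, expand_bracket]
  exact eq_neg_of_add_eq_zero_left h

/-- The bracket with a dispersionless functional depends at cubic order on the dispersion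
coefficient only. -/
theorem top_expand_bracket_C (hξ : ξ₁ + ξ₂ + ξ₃ = 0) {P : DiffPoly I} {n : ℕ}
    (hP : IsHomogeneousOfDegree P n) (hn : n ≠ 0) (g : SmoothFun I) :
    (expand x ξ₁ ξ₂ ξ₃ (bracket P (C g))).top =
      -evalAt x (derivU I (derivU I (derivU I g))) * dispersionCoeff x n P *
        (ξ₁ ^ (n + 1) + ξ₂ ^ (n + 1) + ξ₃ ^ (n + 1)) := by
  obtain ⟨a₁₂, a₁₃, a₂₃, a, h⟩ := expand_varDeriv hP hn x ξ₁ ξ₂ ξ₃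
  -- The unknown quadratic coefficients enter only through a₁₂ξ₃ + a₁₃ξ₂ + a₂₃ξ₁, and translation
  -- invariance makes this combination zero.
  obtain ⟨R, hR⟩ := exists_varDeriv_mul_X_zero P
  have h0 : (expand x ξ₁ ξ₂ ξ₃ (varDeriv P * X 0)).top = 0 := by
    rw [hR, expand_totalDeriv, TripleJet.top_deriv hξ]
  rw [map_mul, h, expand_X, TripleJet.mk_mul_mk] at h0
  rw [bracket, varDeriv_C, totalDeriv_C, map_mul, map_mul, h, expand_X, expand_C,
    TripleJet.mk_mul_mk, TripleJet.mk_mul_mk]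
  dsimp only at h0 ⊢
  obtain rfl : ξ₃ = -ξ₁ - ξ₂ := by linear_combination hξ
  linear_combination evalAt x (derivU I (derivU I g)) * h0

theorem top_expand_bracket_C_left (hξ : ξ₁ + ξ₂ + ξ₃ = 0) {P : DiffPoly I} {n : ℕ}
    (hP : IsHomogeneousOfDegree P n) (hn : n ≠ 0) (g : SmoothFun I) :
    (expand x ξ₁ ξ₂ ξ₃ (bracket (C g) P)).top =
      evalAt x (derivU I (derivU I (derivU I g))) * dispersionCoeff x n P *
        (ξ₁ ^ (n + 1) + ξ₂ ^ (n + 1) + ξ₃ ^ (n + 1)) := by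
  rw [top_expand_bracket_comm hξ, top_expand_bracket_C hξ hP hn]
  ring

theorem bracket_eq_zero_of_left {P : DiffPoly I} (hP : varDeriv P = 0) (Q : DiffPoly I) :
    bracket P Q = 0 := by
  rw [bracket, hP, zero_mul]

theorem bracket_eq_zero_of_right (P : DiffPoly I) {Q : DiffPoly I} (hQ : varDeriv Q = 0) :
    bracket P Q = 0 := by
  rw [bracket, hQ, totalDeriv_zero, mul_zero]

/-- With zero dispersion coefficients both variational derivatives start at second order in the sᵢ,
so their product has no cubic part. -/
theorem top_expand_bracket_of_odd {P Q : DiffPoly I} {m n : ℕ} (hP : IsHomogeneousOfDegree P m)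
    (hQ : IsHomogeneousOfDegree Q n) (hm : Odd m) (hn : Odd n) :
    (expand x ξ₁ ξ₂ ξ₃ (bracket P Q)).top = 0 := by
  obtain ⟨a₁₂, a₁₃, a₂₃, a, h⟩ := expand_varDeriv hP hm.pos.ne' x ξ₁ ξ₂ ξ₃
  obtain ⟨b₁₂, b₁₃, b₂₃, b, h'⟩ := expand_varDeriv hQ hn.pos.ne' x ξ₁ ξ₂ ξ₃
  rw [expand_bracket, h, h', dispersionCoeff_eq_zero_of_odd x hm,
    dispersionCoeff_eq_zero_of_odd x hn, TripleJet.deriv_mk, TripleJet.mk_mul_mk]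
  dsimp only
  ring

/-- The resonant cubic part of the bracket of two functionals in normal form of degree four. -/
theorem top_expand_bracket_normal_form_four (hξ : ξ₁ + ξ₂ + ξ₃ = 0) {P Q : DiffPoly I}
    {p r q s : SmoothFun I} (hP : varDeriv P = varDeriv (C p * X 1 ^ 2 + C r * X 0 ^ 4))
    (hQ : varDeriv Q = varDeriv (C q * X 1 ^ 2 + C s * X 0 ^ 4)) :
    (expand x ξ₁ ξ₂ ξ₃ (bracket P Q)).top =
      4 * (evalAt x q * evalAt x (derivU I p) - evalAt x p * evalAt x (derivU I q)) *
        (ξ₁ * ξ₂ + ξ₁ * ξ₃ + ξ₂ * ξ₃) ^ 2 * (ξ₁ ^ 5 + ξ₂ ^ 5 + ξ₃ ^ 5) := by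
  obtain ⟨a, h⟩ := expand_varDeriv_normal_form_four x ξ₁ ξ₂ ξ₃ p r
  obtain ⟨b, h'⟩ := expand_varDeriv_normal_form_four x ξ₁ ξ₂ ξ₃ q s
  rw [expand_bracket, hP, hQ, h, h', TripleJet.deriv_mk, TripleJet.mk_mul_mk]
  obtain rfl : ξ₃ = -ξ₁ - ξ₂ := by linear_combination hξ
  dsimp only
  ring

theorem dispersionCoeff_two (x : I) {P : DiffPoly I} (hP : IsHomogeneousOfDegree P 2)
    {q : SmoothFun I} (h : varDeriv P = varDeriv (C q * X 0 ^ 2)) :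
    dispersionCoeff x 2 P = -(2 * evalAt x q) := by
  have h1 := (isLinearPart_c₁ x 1 0 0).varDeriv hP
  rw [h, c₁_expand_varDeriv_X_zero_sq] at h1
  linear_combination -h1

theorem dispersionCoeff_four (x : I) {P : DiffPoly I} (hP : IsHomogeneousOfDegree P 4)
    {q r : SmoothFun I} (h : varDeriv P = varDeriv (C q * X 1 ^ 2 + C r * X 0 ^ 4)) :
    dispersionCoeff x 4 P = 2 * evalAt x q := by
  obtain ⟨a, h'⟩ := expand_varDeriv_normal_form_four x 1 0 0 q r
  have h1 := (isLinearPart_c₁ x 1 0 0).varDeriv hP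
  rw [h, h'] at h1
  linear_combination -h1

end Bracket

/-- Wave numbers of a resonant triad: `ξ₁ + ξ₂ + ξ₃ = 0` and `ξ₁⁹ + ξ₂⁹ + ξ₃⁹ = 0`, while the other
symmetric functions of interest do not vanish. -/
theorem exists_resonant_triad : ∃ ξ₁ ξ₂ ξ₃ : ℂ, ξ₁ + ξ₂ + ξ₃ = 0 ∧
    ξ₁ * ξ₂ + ξ₁ * ξ₃ + ξ₂ * ξ₃ = 3 ∧ ξ₁ ^ 3 + ξ₂ ^ 3 + ξ₃ ^ 3 = 27 ∧
    ξ₁ ^ 5 + ξ₂ ^ 5 + ξ₃ ^ 5 = -135 ∧ ξ₁ ^ 9 + ξ₂ ^ 9 + ξ₃ ^ 9 = 0 := by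
  -- For e₁ = 0 the ninth power sum is 3e₃(e₃² - 3e₂³), which vanishes at e₂ = 3, e₃ = 9. The triad
  -- consists of the roots of z³ + 3z - 9.
  obtain ⟨a, ha⟩ : ∃ a : ℂ, a ^ 3 + 3 * a - 9 = 0 := by
    have hd : (Polynomial.X ^ 3 + 3 * Polynomial.X - 9 : Polynomial ℂ).degree ≠ 0 := by
      have : (Polynomial.X ^ 3 + 3 * Polynomial.X - 9 : Polynomial ℂ).degree = 3 := by
        compute_degree!
      rw [this]
      norm_num
    obtain ⟨a, ha⟩ := IsAlgClosed.exists_root _ hd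
    exact ⟨a, by simpa using ha⟩
  -- The discriminant of the remaining factor z² + az + a² + 3.
  obtain ⟨s, hs⟩ := IsAlgClosed.exists_pow_nat_eq (-3 * a ^ 2 - 12) (n := 2) two_pos
  have h2 : a * ((-a + s) / 2) + a * ((-a - s) / 2) + (-a + s) / 2 * ((-a - s) / 2) = 3 := by
    linear_combination -(1 / 4 : ℂ) * hs
  have h3 : a * ((-a + s) / 2) * ((-a - s) / 2) = 9 := by
    linear_combination ha - a / 4 * hs
  refine ⟨a, (-a + s) / 2, (-a - s) / 2, by ring, h2, ?_⟩
  generalize hb : (-a + s) / 2 = b at *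
  obtain hc : (-a - s) / 2 = -a - b := by rw [← hb]; ring
  rw [hc] at h2 h3 ⊢
  generalize he : a * b + a * (-a - b) + b * (-a - b) = e₂ at h2
  generalize he' : a * b * (-a - b) = e₃ at h3
  refine ⟨?_, ?_, ?_⟩
  · calc a ^ 3 + b ^ 3 + (-a - b) ^ 3 = 3 * e₃ := by rw [← he']; ring
      _ = 27 := by rw [h3]; norm_num
  · calc a ^ 5 + b ^ 5 + (-a - b) ^ 5 = -5 * e₂ * e₃ := by rw [← he, ← he']; ring
      _ = -135 := by rw [h2, h3]; norm_num
  · calc a ^ 9 + b ^ 9 + (-a - b) ^ 9 = 3 * e₃ ^ 3 - 9 * e₂ ^ 3 * e₃ := by rw [← he, ← he']; ring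
      _ = 0 := by rw [h2, h3]; norm_num

/-! ### Derivatives of powers of `u` -/

theorem derivU_coordU : derivU I (coordU I) = 1 := by
  ext x
  have h : HopfPerturbation.ext (coordU I).1 =ᶠ[nhds (x : ℝ)] id := by
    filter_upwards [I.isOpen.mem_nhds x.2] with y hy
    exact ext_of_mem _ (show y ∈ I from hy)
  change deriv (HopfPerturbation.ext (coordU I).1) x = 1
  rw [h.deriv_eq, deriv_id]

theorem derivU_coordU_pow (n : ℕ) :
    derivU I (coordU I ^ (n + 1)) = ((n : ℝ) + 1) • coordU I ^ n := by
  rw [Derivation.leibniz_pow, derivU_coordU, Nat.add_sub_cancel, smul_eq_mul, mul_one,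
    ← Nat.cast_smul_eq_nsmul ℝ, Nat.cast_succ]

theorem derivU_three_hopfDensity :
    derivU I (derivU I (derivU I (hopfDensity I))) = 1 := by
  rw [hopfDensity]
  simp only [Derivation.map_smul, derivU_coordU_pow, pow_one, derivU_coordU, smul_smul]
  norm_num

theorem derivU_three_coordU_pow_four :
    derivU I (derivU I (derivU I ((1 / 24 : ℝ) • coordU I ^ 4))) = coordU I := by
  simp only [Derivation.map_smul, derivU_coordU_pow, pow_one, smul_smul]
  norm_num

end HopfPerturbation

end

/-! ### The obstruction at order eight -/

open MvPolynomial HopfPerturbation in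
/-- If `p` is not identically zero, then no perturbation of the Hopf Hamiltonian that coincides with
`∫ (u³/6 + ε⁴ p(u) u_xx²) dx` up to terms of order five and higher in `ε` is 9-integrable. -/
theorem mainTheorem2 (I : TopologicalSpace.Opens ℝ) (p : HopfPerturbation.SmoothFun I)
    (hp : ∃ u : I, p.1 u ≠ 0) :
    ¬ ∃ H : HopfPerturbation.PerturbedHamiltonian I (HopfPerturbation.hopfDensity I),
      HopfPerturbation.AgreeUpTo 4 H (HopfPerturbation.quinticHamiltonian p) ∧
        HopfPerturbation.IsIntegrable 9 H := by
  rintro ⟨H, hH, F, hF, hcomm⟩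
  obtain ⟨ξ₁, ξ₂, ξ₃, hξ, e2, p3, p5, p9⟩ := exists_resonant_triad
  set h := (F (hopfDensity I)).h
  set k := (F ((1 / 24 : ℝ) • coordU I ^ 4)).h
  have hh' : ∀ n, IsHomogeneousOfDegree (h n) n := (F _).homogeneous
  have hk' : ∀ n, IsHomogeneousOfDegree (k n) n := (F _).homogeneous
  have hh0 : h 0 = C (hopfDensity I) := (F _).leading
  have hk0 : k 0 = C ((1 / 24 : ℝ) • coordU I ^ 4) := (F _).leading
  have hvar : ∀ n ≤ 4, varDeriv (h n) = varDeriv ((quinticHamiltonian p).h n) := fun n hn =>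
    (hF n).varDeriv_eq.trans (hH n hn).varDeriv_eq
  have hzero : ∀ n, n ≠ 0 → n < 4 → ∀ Q, bracket (h n) Q = 0 := fun n h0 h4 Q => by
    refine bracket_eq_zero_of_left ?_ Q
    rw [hvar n h4.le]
    change varDeriv (if n = 0 then C (hopfDensity I) else if n = 4 then C p * X 1 ^ 2 else 0) = 0
    rw [if_neg h0, if_neg h4.ne, varDeriv_zero]
  have h4 : varDeriv (h 4) = varDeriv (C p * X 1 ^ 2 + C 0 * X 0 ^ 4) := by
    rw [hvar 4 le_rfl, map_zero, zero_mul, add_zero]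
    rfl
  -- Commutation at order n, tested on the resonant triad at an arbitrary point x.
  have order : ∀ (x : I) (n : ℕ), n ≤ 9 →
      ∑ i ∈ Finset.range (n + 1), (expand x ξ₁ ξ₂ ξ₃ (bracket (h i) (k (n - i)))).top = 0 := by
    intro x n hn
    have := (hcomm (hopfDensity I) ((1 / 24 : ℝ) • coordU I ^ 4) n hn).top_expand (x := x) hξ
    rw [Finset.Nat.sum_antidiagonal_eq_sum_range_succ (fun i j => bracket (h i) (k j)),
      map_sum] at this
    rw [← this]
    exact (map_sum (AddMonoidHom.mk' TripleJet.top TripleJet.top_add) _ _).symm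
  have h1 : ∀ x : I, evalAt x (derivU I (derivU I (derivU I (hopfDensity I)))) = 1 := fun x => by
    rw [derivU_three_hopfDensity, map_one]
  have htop0 : (0 : TripleJet).top = 0 := rfl
  obtain ⟨q₂, hq₂⟩ := exists_normal_form_two (hk' 2)
  have hk2 : varDeriv (k 2) = 0 := by
    have hq : q₂ = 0 := by
      ext x
      have := order x 2 (by norm_num)
      simp only [Finset.sum_range_succ, Finset.sum_range_zero] at this
      rw [hzero 1 (by decide) (by decide), hzero 2 (by decide) (by decide), map_zero, htop0, hh0,
        top_expand_bracket_C_left hξ (hk' 2) two_ne_zero, h1, dispersionCoeff_two x (hk' 2) hq₂,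
        p3] at this
      -- Here 54 = 2 · 27, with 27 the cubic power sum.
      have hq : evalAt x q₂ = 0 := by linear_combination -(1 / 54 : ℂ) * this
      exact Complex.ofReal_eq_zero.1 hq
    rw [hq₂, hq, map_zero, zero_mul, varDeriv_zero]
  obtain ⟨q, r, hqr⟩ := exists_normal_form_four (hk' 4)
  -- The dispersion coefficients of k₄ and h₄ are in the ratio g''' : f''' = u : 1, as the fifth
  -- power sum is nonzero.
  have hq : q = coordU I * p := by
    ext x
    have := order x 4 (by norm_num)
    simp only [Finset.sum_range_succ, Finset.sum_range_zero] at this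
    rw [hzero 1 (by decide) (by decide), hzero 2 (by decide) (by decide),
      hzero 3 (by decide) (by decide), map_zero, htop0, hh0, hk0,
      top_expand_bracket_C_left hξ (hk' 4) four_ne_zero, h1, dispersionCoeff_four x (hk' 4) hqr,
      top_expand_bracket_C hξ (hh' 4) four_ne_zero, dispersionCoeff_four x (hh' 4) h4,
      derivU_three_coordU_pow_four, p5] at this
    have hq : evalAt x q = evalAt x (coordU I * p) := by
      rw [map_mul]
      linear_combination -(1 / 270 : ℂ) * this
    exact Complex.ofReal_injective hq
  obtain ⟨x, hx⟩ := hp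
  -- The end terms carry the ninth power sum 0, h₁, h₂, h₃ and k₂ are trivial, and the pairs (5, 3)
  -- and (7, 1) are odd. Only the pair (4, 4) survives.
  have := order x 8 (by norm_num)
  simp only [Finset.sum_range_succ, Finset.sum_range_zero] at this
  rw [hzero 1 (by decide) (by decide), hzero 2 (by decide) (by decide),
    hzero 3 (by decide) (by decide), map_zero, htop0, hh0, hk0,
    top_expand_bracket_C_left hξ (hk' 8) (by decide), top_expand_bracket_C hξ (hh' 8) (by decide),
    top_expand_bracket_of_odd (hh' 5) (hk' 3) (by decide) (by decide),
    top_expand_bracket_of_odd (hh' 7) (hk' 1) (by decide) (by decide),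
    bracket_eq_zero_of_right (h 6) hk2, map_zero, htop0, p9,
    top_expand_bracket_normal_form_four hξ h4 hqr, hq, Derivation.leibniz, derivU_coordU, e2,
    p5] at this
  simp only [smul_eq_mul, map_add, map_mul, map_one] at this
  -- The surviving term is 4 · (-p²) · 3² · (-135) = 4860 p².
  have hsq : evalAt x p ^ 2 = 0 := by linear_combination (1 / 4860 : ℂ) * this
  exact hx (Complex.ofReal_eq_zero.1 (pow_eq_zero_iff two_ne_zero |>.1 hsq))
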